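/- Let $\mathbb{K}\subset\mathbb{C}$ be a subfield (for instance a subfield of $\overline{\mathbb{Q}}\subset\mathbb{C}$). Let $(\mathbb{K},\mathbb{Q})\text{-Vect}$ be the category of tuples $(V_\mathbb{K},V_\mathbb{Q},\phi)$, where $V_\mathbb{K}$ and $V_\mathbb{Q}$ are finite-dimensional vector spaces over $\mathbb{K}$ and $\mathbb{Q}$, respectively, and $\phi:V_\mathbb{K}\otimes_\mathbb{K}\mathbb{C}\to V_\mathbb{Q}\otimes_\mathbb{Q}\mathbb{C}$ is a $\mathbb{C}$-linear isomorphism; morphisms are pairs of linear maps compatible with the isomorphisms $\phi$. Let $\mathcal{C}$ be an abelian $\mathbb{Q}$-linear category and $T:\mathcal{C}\to(\mathbb{K},\mathbb{Q})\text{-Vect}$, $M\mapsto (T_{\mathrm{dR}}(M),T_{\mathrm{sing}}(M),\phi_M)$, a faithful exact functor. The space of formal periods $\tilde{\mathcal P}(\mathcal{C})$ is the $\mathbb{Q}$-vector space generated by symbols $(M,\sigma,\omega)$ with $M\in\mathcal{C}$, $\sigma\in T_{\mathrm{sing}}(M)^\vee$, $\omega\in T_{\mathrm{dR}}(M)$,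 modulo $\mathbb{Q}$-bilinearity in $\sigma$ and $\omega$ and the relations $(M,f^*\sigma,\omega)=(N,\sigma,f_*\omega)$ for all morphisms $f:M\to N$ in $\mathcal{C}$. Nori's coalgebra $\mathcal{A}(\mathcal{C})$ is the quotient of the $\mathbb{Q}$-coalgebra $\bigoplus_{M\in\mathcal{C}}\mathrm{End}_\mathbb{Q}(T_{\mathrm{sing}}(M))^\vee$ by the functoriality relations: for every $f:M\to N$ in $\mathcal{C}$ and every linear form $l$ on $\mathrm{Hom}_\mathbb{Q}(T_{\mathrm{sing}}(M),T_{\mathrm{sing}}(N))$, the form $a\mapsto l(f_*\circ a)$ on $\mathrm{End}_\mathbb{Q}(T_{\mathrm{sing}}(M))$ is identified with the form $b\mapsto l(b\circ f_*)$ on $\mathrm{End}_\mathbb{Q}(T_{\mathrm{sing}}(N))$. Let $\mathcal{C}'$ be an abelian $\mathbb{Q}$-linear category which is a (not necessarily full) subcategory of $\mathcal{C}$ with exact inclusion functor (more generally, let $\iota:\mathcal{C}'\to\mathcal{C}$ be a faithful exact functor), and define $\tilde{\mathcal P}(\mathcal{C}')$ and $\mathcal{A}(\mathcal{C}')$ using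 the restriction of $T$ to $\mathcal{C}'$. Then the following are equivalent: 1. $\mathcal{C}'$ is closed under subquotients in $\mathcal{C}$, i.e. every subobject and every quotient object in $\mathcal{C}$ of an object $X$ of $\mathcal{C}'$ is isomorphic, as a subobject or quotient object of $X$, to one given by an object of $\mathcal{C}'$ together with a morphism of $\mathcal{C}'$ to, respectively from, $X$; 2. the natural map $\tilde{\mathcal P}(\mathcal{C}')\to\tilde{\mathcal P}(\mathcal{C})$ is injective; 3. the natural map of coalgebras $\mathcal{A}(\mathcal{C}')\to\mathcal{A}(\mathcal{C})$ is injective. -/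

import Mathlib

open CategoryTheory CategoryTheory.Limits
open scoped TensorProduct

universe w u v u' v'

noncomputable section

/-! ### The category `(K, ℚ)-Vect` -/

/-- A tuple `(V_K, V_ℚ, φ)`: a finite dimensional `K`-vector space, a finite dimensional
`ℚ`-vector space and an isomorphism `φ : V_K ⊗_K ℂ → V_ℚ ⊗_ℚ ℂ`
(`K` is a field with a fixed embedding into `ℂ`). -/
structure KQVect (K : Type*) [Field K] [Algebra K ℂ] where
  /-- the `K`-vector space `V_K` -/
  dR : Type w
  /-- the `ℚ`-vector space `V_ℚ` -/
  sing : Type w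
  [addCommGroupDR : AddCommGroup dR]
  [moduleDR : Module K dR]
  [finiteDR : Module.Finite K dR]
  [addCommGroupSing : AddCommGroup sing]
  [moduleSing : Module ℚ sing]
  [finiteSing : Module.Finite ℚ sing]
  /-- the comparison isomorphism `φ` -/
  comparison : (ℂ ⊗[K] dR) ≃ₗ[ℂ] (ℂ ⊗[ℚ] sing)

namespace KQVect

attribute [instance] addCommGroupDR moduleDR finiteDR addCommGroupSing moduleSing finiteSing

variable {K : Type*} [Field K] [Algebra K ℂ]

/-- A morphism: a `K`-linear map and a `ℚ`-linear map compatible with the comparison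
isomorphisms. -/
@[ext]
structure Hom (V W : KQVect.{w} K) where
  /-- the `K`-linear component -/
  dR : V.dR →ₗ[K] W.dR
  /-- the `ℚ`-linear component -/
  sing : V.sing →ₗ[ℚ] W.sing
  comm : W.comparison.toLinearMap ∘ₗ dR.baseChange ℂ =
    sing.baseChange ℂ ∘ₗ V.comparison.toLinearMap

instance : Category (KQVect.{w} K) where
  Hom V W := Hom V W
  id V := ⟨LinearMap.id, LinearMap.id, by
    rw [LinearMap.baseChange_id, LinearMap.baseChange_id]; rfl⟩
  comp f g := ⟨g.dR ∘ₗ f.dR, g.sing ∘ₗ f.sing, by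
    rw [LinearMap.baseChange_comp, LinearMap.baseChange_comp, ← LinearMap.comp_assoc, g.comm,
      LinearMap.comp_assoc, f.comm, LinearMap.comp_assoc]⟩

end KQVect

/-! ### Formal periods -/

section FormalPeriods

variable {K : Type*} [Field K] [Algebra K ℂ]
variable {C : Type u} [Category.{v} C] (T : C ⥤ KQVect.{w} K)

/-- A symbol `(M, σ, ω)` with `M ∈ C`, `σ ∈ T(M)_ℚ^∨` and `ω ∈ T(M)_K`. -/
structure PeriodSymbol where
  /-- the object -/
  obj : C
  /-- the dual vector `σ` -/
  sigma : Module.Dual ℚ (T.obj obj).sing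
  /-- the vector `ω` -/
  omega : (T.obj obj).dR

/-- The generator of the free `ℚ`-vector space on the symbols that belongs to `(M, σ, ω)`. -/
abbrev periodGenerator (M : C) (σ : Module.Dual ℚ (T.obj M).sing) (ω : (T.obj M).dR) :
    PeriodSymbol T →₀ ℚ :=
  Finsupp.single ⟨M, σ, ω⟩ 1

/-- The defining relations between the symbols: `ℚ`-bilinearity in `σ` and `ω`, and functoriality
`(M, f^* σ, ω) = (N, σ, f_* ω)` for all morphisms `f : M ⟶ N`. -/
inductive IsPeriodRelation : (PeriodSymbol T →₀ ℚ) → Prop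
  | add_sigma (M : C) (σ τ : Module.Dual ℚ (T.obj M).sing) (ω : (T.obj M).dR) :
      IsPeriodRelation (periodGenerator T M (σ + τ) ω -
        (periodGenerator T M σ ω + periodGenerator T M τ ω))
  | smul_sigma (M : C) (q : ℚ) (σ : Module.Dual ℚ (T.obj M).sing) (ω : (T.obj M).dR) :
      IsPeriodRelation (periodGenerator T M (q • σ) ω - q • periodGenerator T M σ ω)
  | add_omega (M : C) (σ : Module.Dual ℚ (T.obj M).sing) (ω η : (T.obj M).dR) :
      IsPeriodRelation (periodGenerator T M σ (ω + η) -
        (periodGenerator T M σ ω + periodGenerator T M σ η))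
  | smul_omega (M : C) (q : ℚ) (σ : Module.Dual ℚ (T.obj M).sing) (ω : (T.obj M).dR) :
      IsPeriodRelation (periodGenerator T M σ ((q : K) • ω) - q • periodGenerator T M σ ω)
  | functoriality {M N : C} (f : M ⟶ N) (σ : Module.Dual ℚ (T.obj N).sing) (ω : (T.obj M).dR) :
      IsPeriodRelation (periodGenerator T M (σ ∘ₗ (T.map f).sing) ω -
        periodGenerator T N σ ((T.map f).dR ω))

/-- The span of the defining relations. -/
def periodRelations : Submodule ℚ (PeriodSymbol T →₀ ℚ) :=
  Submodule.span ℚ {x | IsPeriodRelation T x}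

/-- The space of formal periods of `C` (with respect to `T`). -/
abbrev FormalPeriods : Type _ := (PeriodSymbol T →₀ ℚ) ⧸ periodRelations T

variable {C' : Type u'} [Category.{v'} C'] (ι : C' ⥤ C)

/-- The map on symbols `(M, σ, ω) ↦ (ι M, σ, ω)`. -/
def PeriodSymbol.map (s : PeriodSymbol (ι ⋙ T)) : PeriodSymbol T :=
  ⟨ι.obj s.obj, s.sigma, s.omega⟩

lemma periodRelations_le_comap :
    periodRelations (ι ⋙ T) ≤
      (periodRelations T).comap (Finsupp.lmapDomain ℚ ℚ (PeriodSymbol.map T ι)) := by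
  refine Submodule.span_le.2 ?_
  intro x hx
  refine Submodule.subset_span ?_
  have key : ∀ (M : C') (σ : Module.Dual ℚ ((ι ⋙ T).obj M).sing) (ω : ((ι ⋙ T).obj M).dR),
      Finsupp.lmapDomain ℚ ℚ (PeriodSymbol.map T ι) (periodGenerator (ι ⋙ T) M σ ω) =
        periodGenerator T (ι.obj M) σ ω := fun M σ ω => by
    rw [Finsupp.lmapDomain_apply, Finsupp.mapDomain_single]; rfl
  rcases hx with ⟨M, σ, τ, ω⟩ | ⟨M, q, σ, ω⟩ | ⟨M, σ, ω, η⟩ | ⟨M, q, σ, ω⟩ | ⟨f, σ, ω⟩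
  · simp only [Set.mem_ofPred_eq, map_sub, map_add, key]
    exact .add_sigma (ι.obj M) σ τ ω
  · simp only [Set.mem_ofPred_eq, map_sub, map_smul, key]
    exact .smul_sigma (ι.obj M) q σ ω
  · simp only [Set.mem_ofPred_eq, map_sub, map_add, key]
    exact .add_omega (ι.obj M) σ ω η
  · simp only [Set.mem_ofPred_eq, map_sub, map_smul, key]
    exact .smul_omega (ι.obj M) q σ ω
  · simp only [Set.mem_ofPred_eq, map_sub, key]
    exact .functoriality (ι.map f) σ ω

/-- The natural map from the formal periods of `C'` (with respect to `T ∘ ι`) to the formal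
periods of `C` (with respect to `T`), `(M, σ, ω) ↦ (ι M, σ, ω)`. -/
def FormalPeriods.map : FormalPeriods (ι ⋙ T) →ₗ[ℚ] FormalPeriods T :=
  Submodule.mapQ _ _ (Finsupp.lmapDomain ℚ ℚ (PeriodSymbol.map T ι))
    (periodRelations_le_comap T ι)

end FormalPeriods

/-! ### The coalgebra dual to a finite dimensional algebra -/

section DualCoalgebra

/-- The map `Z^∨ → X^∨ ⊗ Y^∨` dual to a bilinear map `X × Y → Z` of finite dimensional spaces. -/
def dualComul {X Y Z : Type*} [AddCommGroup X] [Module ℚ X] [Module.Finite ℚ X]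
    [AddCommGroup Y] [Module ℚ Y] [Module.Finite ℚ Y] [AddCommGroup Z] [Module ℚ Z]
    (m : X →ₗ[ℚ] Y →ₗ[ℚ] Z) :
    Module.Dual ℚ Z →ₗ[ℚ] Module.Dual ℚ X ⊗[ℚ] Module.Dual ℚ Y :=
  (TensorProduct.dualDistribEquiv ℚ X Y).symm.toLinearMap ∘ₗ (TensorProduct.lift m).dualMap

section

variable {X Y Z : Type*} [AddCommGroup X] [Module ℚ X] [Module.Finite ℚ X]
    [AddCommGroup Y] [Module ℚ Y] [Module.Finite ℚ Y] [AddCommGroup Z] [Module ℚ Z]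

/-- Pairing `X^∨ ⊗ Y^∨` with `(x, y)`. -/
abbrev dualPair (t : Module.Dual ℚ X ⊗[ℚ] Module.Dual ℚ Y) (x : X) (y : Y) : ℚ :=
  TensorProduct.dualDistrib ℚ X Y t (x ⊗ₜ y)

lemma dualPair_ext {s t : Module.Dual ℚ X ⊗[ℚ] Module.Dual ℚ Y}
    (h : ∀ x y, dualPair s x y = dualPair t x y) : s = t := by
  apply (TensorProduct.dualDistribEquiv ℚ X Y).injective
  exact TensorProduct.ext' h

lemma dualPair_dualComul (m : X →ₗ[ℚ] Y →ₗ[ℚ] Z) (l : Module.Dual ℚ Z) (x : X) (y : Y) :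
    dualPair (dualComul m l) x y = l (m x y) := by
  have h : TensorProduct.dualDistrib ℚ X Y (dualComul m l) = (TensorProduct.lift m).dualMap l :=
    (TensorProduct.dualDistribEquiv ℚ X Y).apply_symm_apply _
  rw [dualPair, h]
  simp

end

variable (E : Type*) [Ring E] [Algebra ℚ E] [Module.Finite ℚ E]

/-- The dual `E^∨` of a finite dimensional algebra `E`: the comultiplication is dual to the
multiplication of `E`, the counit is evaluation at `1`. -/
instance dualCoalgebraStruct : CoalgebraStruct ℚ (Module.Dual ℚ E) where
  comul := dualComul (LinearMap.mul ℚ E)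
  counit := Module.Dual.eval ℚ E 1

lemma dualPair_comul (l : Module.Dual ℚ E) (x y : E) :
    dualPair (CoalgebraStruct.comul (R := ℚ) l) x y = l (x * y) :=
  dualPair_dualComul _ _ _ _

instance dualCoalgebra : Coalgebra ℚ (Module.Dual ℚ E) where
  coassoc := by
    ext l
    have hinj : Function.Injective
        (LinearMap.lTensor (Module.Dual ℚ E) (TensorProduct.dualDistrib ℚ E E)) :=
      ((TensorProduct.dualDistribEquiv ℚ E E).lTensor (Module.Dual ℚ E)).injective
    apply hinj
    apply dualPair_ext
    intro x yz
    induction yz with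
    | zero => simp [dualPair]
    | add a b ha hb => simp only [dualPair, TensorProduct.tmul_add, map_add] at *; rw [ha, hb]
    | tmul y z =>
      have h2 : ∀ (w : Module.Dual ℚ E ⊗[ℚ] Module.Dual ℚ E) (ψ : Module.Dual ℚ E),
          dualPair (LinearMap.lTensor (Module.Dual ℚ E) (TensorProduct.dualDistrib ℚ E E)
            (TensorProduct.assoc ℚ _ _ _ (w ⊗ₜ ψ))) x (y ⊗ₜ z) = dualPair w x y * ψ z := by
        intro w ψ
        induction w with
        | zero => simp [dualPair]
        | add a b ha hb => simp only [dualPair, TensorProduct.add_tmul, map_add,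
            LinearMap.add_apply, add_mul] at *; rw [ha, hb]
        | tmul a b => simp [dualPair, mul_assoc]
      have h3 : ∀ w : Module.Dual ℚ E ⊗[ℚ] Module.Dual ℚ E,
          dualPair (LinearMap.lTensor (Module.Dual ℚ E) (TensorProduct.dualDistrib ℚ E E)
            (TensorProduct.assoc ℚ _ _ _ (CoalgebraStruct.comul.rTensor (Module.Dual ℚ E) w)))
              x (y ⊗ₜ z) = dualPair w (x * y) z := by
        intro w
        induction w with
        | zero => simp [dualPair]
        | add a b ha hb => simp only [dualPair, map_add, LinearMap.add_apply] at *; rw [ha, hb]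
        | tmul a b =>
          rw [LinearMap.rTensor_tmul, h2, dualPair_comul]
          simp [dualPair]
      have h4 : ∀ w : Module.Dual ℚ E ⊗[ℚ] Module.Dual ℚ E,
          dualPair (LinearMap.lTensor (Module.Dual ℚ E) (TensorProduct.dualDistrib ℚ E E)
            (CoalgebraStruct.comul.lTensor (Module.Dual ℚ E) w))
              x (y ⊗ₜ z) = dualPair w x (y * z) := by
        intro w
        induction w with
        | zero => simp [dualPair]
        | add a b ha hb => simp only [dualPair, map_add, LinearMap.add_apply] at *; rw [ha, hb]
        | tmul a b =>
          rw [LinearMap.lTensor_tmul, LinearMap.lTensor_tmul, dualPair,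
            TensorProduct.dualDistrib_apply]
          have := dualPair_comul E b y z
          rw [dualPair] at this
          rw [this, dualPair, TensorProduct.dualDistrib_apply]
      simp only [LinearMap.comp_apply, LinearEquiv.coe_coe]
      rw [h3, h4, dualPair_comul, dualPair_comul, mul_assoc]
  rTensor_counit_comp_comul := by
    ext l
    apply (TensorProduct.lid ℚ (Module.Dual ℚ E)).injective
    ext x
    have h : ∀ w : Module.Dual ℚ E ⊗[ℚ] Module.Dual ℚ E,
        TensorProduct.lid ℚ (Module.Dual ℚ E)
          (CoalgebraStruct.counit.rTensor (Module.Dual ℚ E) w) x = dualPair w 1 x := by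
      intro w
      induction w with
      | zero => simp [dualPair]
      | add a b ha hb => simp only [dualPair, map_add, LinearMap.add_apply] at *; rw [ha, hb]
      | tmul a b => simp [dualPair, CoalgebraStruct.counit]
    rw [LinearMap.comp_apply, h, dualPair_comul]
    simp
  lTensor_counit_comp_comul := by
    ext l
    apply (TensorProduct.rid ℚ (Module.Dual ℚ E)).injective
    ext x
    have h : ∀ w : Module.Dual ℚ E ⊗[ℚ] Module.Dual ℚ E,
        TensorProduct.rid ℚ (Module.Dual ℚ E)
          (CoalgebraStruct.counit.lTensor (Module.Dual ℚ E) w) x = dualPair w x 1 := by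
      intro w
      induction w with
      | zero => simp [dualPair]
      | add a b ha hb => simp only [dualPair, map_add, LinearMap.add_apply] at *; rw [ha, hb]
      | tmul a b => simp [dualPair, CoalgebraStruct.counit, mul_comm]
    rw [LinearMap.comp_apply, h, dualPair_comul]
    simp

end DualCoalgebra

/-! ### Nori's coalgebra -/

section Nori

variable {K : Type*} [Field K] [Algebra K ℂ]
variable {C : Type u} [Category.{v} C] (T : C ⥤ KQVect.{w} K)

/-- `A(M) = End_ℚ(T_sing(M))^∨`, a coalgebra. -/
abbrev EndDual (M : C) : Type w := Module.Dual ℚ (Module.End ℚ (T.obj M).sing)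

variable {T} in
/-- For `f : M ⟶ N` and a linear form `l` on `Hom_ℚ(T_sing(M), T_sing(N))`,
the linear form `a ↦ l (f_* ∘ a)` on `End_ℚ(T_sing(M))`. -/
def EndDual.ofSource {M N : C} (f : M ⟶ N) :
    Module.Dual ℚ ((T.obj M).sing →ₗ[ℚ] (T.obj N).sing) →ₗ[ℚ] EndDual T M :=
  (LinearMap.llcomp ℚ (T.obj M).sing (T.obj M).sing (T.obj N).sing (T.map f).sing).dualMap

variable {T} in
/-- For `f : M ⟶ N` and a linear form `l` on `Hom_ℚ(T_sing(M), T_sing(N))`,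
the linear form `b ↦ l (b ∘ f_*)` on `End_ℚ(T_sing(N))`. -/
def EndDual.ofTarget {M N : C} (f : M ⟶ N) :
    Module.Dual ℚ ((T.obj M).sing →ₗ[ℚ] (T.obj N).sing) →ₗ[ℚ] EndDual T N :=
  (LinearMap.lcomp ℚ (T.obj N).sing (T.map f).sing).dualMap

open scoped Classical in
/-- The functoriality relations in `⨁_M A(M)`: for all `f : M ⟶ N` and all linear forms `l` on
`Hom_ℚ(T_sing(M), T_sing(N))`, the form `a ↦ l (f_* ∘ a)` in `A(M)` is identified with the form
`b ↦ l (b ∘ f_*)` in `A(N)`. -/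
def noriRelations : Submodule ℚ (Π₀ M : C, EndDual T M) :=
  Submodule.span ℚ {x | ∃ (M N : C) (f : M ⟶ N)
    (l : Module.Dual ℚ ((T.obj M).sing →ₗ[ℚ] (T.obj N).sing)),
    x = DFinsupp.single M (EndDual.ofSource f l) - DFinsupp.single N (EndDual.ofTarget f l)}

/-- Nori's coalgebra `A(C) = (⨁_M A(M)) / functoriality`. -/
abbrev NoriCoalgebra : Type _ := (Π₀ M : C, EndDual T M) ⧸ noriRelations T

open scoped Classical in
/-- The natural map `A(M) → A(C)`. -/
def NoriCoalgebra.of (M : C) : EndDual T M →ₗ[ℚ] NoriCoalgebra T :=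
  (noriRelations T).mkQ ∘ₗ DFinsupp.lsingle M

lemma NoriCoalgebra.of_comp_ofSource {M N : C} (f : M ⟶ N) :
    NoriCoalgebra.of T M ∘ₗ EndDual.ofSource f = NoriCoalgebra.of T N ∘ₗ EndDual.ofTarget f := by
  ext l
  exact (Submodule.Quotient.eq _).2 (Submodule.subset_span ⟨M, N, f, l, rfl⟩)

lemma dualPair_map {X Y X' Y' : Type*} [AddCommGroup X] [Module ℚ X] [AddCommGroup Y] [Module ℚ Y]
    [AddCommGroup X'] [Module ℚ X'] [AddCommGroup Y'] [Module ℚ Y']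
    (g : X' →ₗ[ℚ] X) (h : Y' →ₗ[ℚ] Y) (t : Module.Dual ℚ X ⊗[ℚ] Module.Dual ℚ Y) (x : X') (y : Y') :
    dualPair (TensorProduct.map g.dualMap h.dualMap t) x y = dualPair t (g x) (h y) := by
  induction t with
  | zero => simp [dualPair]
  | add a b ha hb => simp only [dualPair, map_add, LinearMap.add_apply] at *; rw [ha, hb]
  | tmul a b => simp [dualPair]

lemma NoriCoalgebra.map_of_comul {M N : C} (f : M ⟶ N)
    (l : Module.Dual ℚ ((T.obj M).sing →ₗ[ℚ] (T.obj N).sing)) :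
    TensorProduct.map (NoriCoalgebra.of T M) (NoriCoalgebra.of T M)
        (CoalgebraStruct.comul (EndDual.ofSource f l)) =
      TensorProduct.map (NoriCoalgebra.of T N) (NoriCoalgebra.of T N)
        (CoalgebraStruct.comul (EndDual.ofTarget f l)) := by
  set t₁ := dualComul (LinearMap.llcomp ℚ (T.obj M).sing (T.obj M).sing (T.obj N).sing :
    ((T.obj M).sing →ₗ[ℚ] (T.obj N).sing) →ₗ[ℚ] Module.End ℚ (T.obj M).sing →ₗ[ℚ]
      ((T.obj M).sing →ₗ[ℚ] (T.obj N).sing)) l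
  set t₂ := dualComul (LinearMap.llcomp ℚ (T.obj M).sing (T.obj N).sing (T.obj N).sing :
    Module.End ℚ (T.obj N).sing →ₗ[ℚ] ((T.obj M).sing →ₗ[ℚ] (T.obj N).sing) →ₗ[ℚ]
      ((T.obj M).sing →ₗ[ℚ] (T.obj N).sing)) l
  have e₁ : CoalgebraStruct.comul (EndDual.ofSource f l) =
      TensorProduct.map (EndDual.ofSource f) LinearMap.id t₁ := by
    rw [← LinearMap.dualMap_id]
    apply dualPair_ext
    intro x y
    rw [EndDual.ofSource, dualPair_map, dualPair_dualComul, dualPair_comul]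
    rfl
  have e₂ : CoalgebraStruct.comul (EndDual.ofTarget f l) =
      TensorProduct.map LinearMap.id (EndDual.ofTarget f) t₂ := by
    rw [← LinearMap.dualMap_id]
    apply dualPair_ext
    intro x y
    rw [EndDual.ofTarget, dualPair_map, dualPair_dualComul, dualPair_comul]
    rfl
  have e₃ : TensorProduct.map (EndDual.ofTarget f) LinearMap.id t₁ =
      TensorProduct.map LinearMap.id (EndDual.ofSource f) t₂ := by
    rw [← LinearMap.dualMap_id, ← LinearMap.dualMap_id]
    apply dualPair_ext
    intro x y
    rw [EndDual.ofTarget, EndDual.ofSource, dualPair_map, dualPair_map, dualPair_dualComul,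
      dualPair_dualComul]
    rfl
  calc _ = TensorProduct.map (NoriCoalgebra.of T M ∘ₗ EndDual.ofSource f)
        (NoriCoalgebra.of T M ∘ₗ LinearMap.id) t₁ := by rw [e₁, TensorProduct.map_map]
    _ = TensorProduct.map (NoriCoalgebra.of T N) (NoriCoalgebra.of T M)
        (TensorProduct.map (EndDual.ofTarget f) LinearMap.id t₁) := by
      rw [NoriCoalgebra.of_comp_ofSource, TensorProduct.map_map]
    _ = TensorProduct.map (NoriCoalgebra.of T N ∘ₗ LinearMap.id)
        (NoriCoalgebra.of T M ∘ₗ EndDual.ofSource f) t₂ := by rw [e₃, TensorProduct.map_map]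
    _ = _ := by rw [NoriCoalgebra.of_comp_ofSource, e₂, TensorProduct.map_map]

open scoped Classical in
/-- The functoriality relations form a coideal, hence `A(C)` is a coalgebra. -/
instance noriRelations_isCoideal : (noriRelations T).IsCoideal where
  counit_eq_zero := by
    have h : noriRelations T ≤ LinearMap.ker (CoalgebraStruct.counit (R := ℚ)) := by
      refine Submodule.span_le.2 ?_
      rintro _ ⟨M, N, f, l, rfl⟩
      simp only [SetLike.mem_coe, LinearMap.mem_ker, map_sub, DFinsupp.counit_single]
      exact sub_self (l (T.map f).sing)
    exact fun x hx => h hx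
  map_mkQ_comul_eq_zero := by
    have h : noriRelations T ≤ LinearMap.ker
        (TensorProduct.map (noriRelations T).mkQ (noriRelations T).mkQ ∘ₗ
          CoalgebraStruct.comul (R := ℚ)) := by
      refine Submodule.span_le.2 ?_
      rintro _ ⟨M, N, f, l, rfl⟩
      simp only [SetLike.mem_coe, LinearMap.mem_ker, map_sub, LinearMap.comp_apply,
        DFinsupp.comul_single, TensorProduct.map_map]
      exact sub_eq_zero.2 (NoriCoalgebra.map_of_comul T f l)
    exact fun x hx => h hx

variable {C' : Type u'} [Category.{v'} C'] (ι : C' ⥤ C)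

open scoped Classical in
/-- The map `⨁_{M ∈ C'} A(ι M) → ⨁_{M ∈ C} A(M)` sending the summand of `M` identically to the
summand of `ι M`. -/
def endDualMap : (Π₀ M : C', EndDual (ι ⋙ T) M) →ₗ[ℚ] (Π₀ M : C, EndDual T M) :=
  DFinsupp.lsum ℚ fun M =>
    (DFinsupp.lsingle (ι.obj M) : EndDual T (ι.obj M) →ₗ[ℚ] (Π₀ M : C, EndDual T M))

open scoped Classical in
lemma endDualMap_single (M : C') (a : EndDual (ι ⋙ T) M) :
    endDualMap T ι (DFinsupp.single M a) =
      DFinsupp.single (β := fun M : C => EndDual T M) (ι.obj M) a :=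
  DFinsupp.lsum_single _ _ _ _

lemma noriRelations_le_comap :
    noriRelations (ι ⋙ T) ≤ (noriRelations T).comap (endDualMap T ι) := by
  refine Submodule.span_le.2 ?_
  rintro _ ⟨M, N, f, l, rfl⟩
  refine Submodule.subset_span ⟨ι.obj M, ι.obj N, ι.map f, l, ?_⟩
  rw [map_sub, endDualMap_single, endDualMap_single]
  rfl

open scoped Classical in
/-- The natural homomorphism of coalgebras `A(C') → A(C)` (with respect to `T ∘ ι` and `T`),
induced by the identity maps `A(M) → A(ι M)`. -/
def NoriCoalgebra.map : NoriCoalgebra (ι ⋙ T) →ₗc[ℚ] NoriCoalgebra T where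
  toLinearMap := Submodule.mapQ _ _ (endDualMap T ι) (noriRelations_le_comap T ι)
  counit_comp := by
    ext M a
    change CoalgebraStruct.counit (R := ℚ) (endDualMap T ι (DFinsupp.single M a)) =
      CoalgebraStruct.counit (R := ℚ) (DFinsupp.single M a)
    rw [endDualMap_single, DFinsupp.counit_single, DFinsupp.counit_single]
  map_comp_comul := by
    ext M a
    change TensorProduct.map _ _ (TensorProduct.map (noriRelations (ι ⋙ T)).mkQ
        (noriRelations (ι ⋙ T)).mkQ (CoalgebraStruct.comul (R := ℚ) (DFinsupp.single M a))) =
      TensorProduct.map (noriRelations T).mkQ (noriRelations T).mkQ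
        (CoalgebraStruct.comul (R := ℚ) (endDualMap T ι (DFinsupp.single M a)))
    have h : (Submodule.mapQ _ _ (endDualMap T ι) (noriRelations_le_comap T ι) ∘ₗ
        (noriRelations (ι ⋙ T)).mkQ) ∘ₗ DFinsupp.lsingle M =
        ((noriRelations T).mkQ ∘ₗ
          (DFinsupp.lsingle (ι.obj M) : EndDual T (ι.obj M) →ₗ[ℚ] (Π₀ M : C, EndDual T M)) :
          EndDual T (ι.obj M) →ₗ[ℚ] NoriCoalgebra T) := by
      ext b
      change (noriRelations T).mkQ (endDualMap T ι (DFinsupp.single M b)) = _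
      rw [endDualMap_single]
      rfl
    rw [endDualMap_single, DFinsupp.comul_single, DFinsupp.comul_single, TensorProduct.map_map,
      TensorProduct.map_map, TensorProduct.map_map, h]

end Nori

/-! ### Closure under subquotients -/

section Subquotients

variable {C : Type u} [Category.{v} C] {C' : Type u'} [Category.{v'} C'] (ι : C' ⥤ C)

/-- A (not necessarily full) subcategory, given by its inclusion functor `ι : C' ⥤ C`, is closed
under subquotients in `C`: every subobject (resp. quotient object) in `C` of an object of `C'` is
a subobject (resp. quotient object) coming from `C'`, i.e. it is, as a subobject (resp. quotient
object), isomorphic to the image of an object of `C'` together with a morphism of `C'`. -/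
structure ClosedUnderSubquotients : Prop where
  sub : ∀ (X : C') (Y : C) (i : Y ⟶ ι.obj X), Mono i →
    ∃ (Y' : C') (j : Y' ⟶ X) (e : ι.obj Y' ≅ Y), e.hom ≫ i = ι.map j
  quot : ∀ (X : C') (Y : C) (p : ι.obj X ⟶ Y), Epi p →
    ∃ (Y' : C') (q : X ⟶ Y') (e : ι.obj Y' ≅ Y), ι.map q ≫ e.hom = p

end Subquotients

end

/-! The heart is a criterion for a symbol to vanish: if `(M, σ, ω)` is zero as a formal period, then
some `f : N ⟶ M` has `ω` in the image of its de Rham component while `σ` kills the image of its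
singular component (`IsFiberFunctor.exists_of_periodGenerator_mem`). Pairs `(M, ω)` form a
cofiltered category, by biproducts and kernels. Formal periods map to the filtered colimit of the
dual spaces of `T(M)_ℚ` over it, and vanishing there is witnessed at a finite stage.

Every formal period is a single symbol, by biproducts. If `C'` is closed under subobjects, the image
of the witness `f` comes from `C'`, so the symbol already vanishes over `C'`; this gives
injectivity.

Conversely, let `i : Y ⟶ ι.obj X` be a subobject with cokernel `π`. For `y` in `T(Y)_K` and a form
`τ` on the singular realisation of the cokernel, the symbol `(X, τ ∘ π, i y)` is zero over `C`,
hence over `C'`. Its witnesses, taken over finitely many `τ` and `y` and summed, give a morphism of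
`C'` with image `Y`. Quotients follow by taking cokernels.

Nori's coalgebra is the space of formal periods of the functor with both realisations singular
(`FormalPeriods.toNori_bijective`). The argument uses only the elementwise properties in
`IsFiberFunctor`, so it covers this case too. -/

noncomputable section

/-! ### Kernels and cokernels in `(K, ℚ)-Vect` -/

/-- Two injective linear maps with the same range have isomorphic sources. -/
lemma LinearMap.exists_equiv_of_range_eq {R X Y Z : Type*} [Ring R] [AddCommGroup X] [Module R X]
    [AddCommGroup Y] [Module R Y] [AddCommGroup Z] [Module R Z] (a : X →ₗ[R] Z) (b : Y →ₗ[R] Z)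
    (ha : Function.Injective a) (hb : Function.Injective b)
    (h : LinearMap.range a = LinearMap.range b) :
    ∃ e : X ≃ₗ[R] Y, b ∘ₗ e.toLinearMap = a := by
  refine ⟨(LinearEquiv.ofInjective a ha).trans
    ((LinearEquiv.ofEq _ _ h).trans (LinearEquiv.ofInjective b hb).symm), ?_⟩
  ext x
  have := congrArg Subtype.val ((LinearEquiv.ofInjective b hb).apply_symm_apply
    (LinearEquiv.ofEq _ _ h (LinearEquiv.ofInjective a ha x)))
  exact this

/-- Two surjective linear maps with the same kernel have isomorphic targets. -/
lemma LinearMap.exists_equiv_of_ker_eq {R X Y Z : Type*} [Ring R] [AddCommGroup X] [Module R X]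
    [AddCommGroup Y] [Module R Y] [AddCommGroup Z] [Module R Z] (a : Z →ₗ[R] X) (b : Z →ₗ[R] Y)
    (ha : Function.Surjective a) (hb : Function.Surjective b)
    (h : LinearMap.ker a = LinearMap.ker b) :
    ∃ e : X ≃ₗ[R] Y, e.toLinearMap ∘ₗ a = b := by
  refine ⟨(a.quotKerEquivOfSurjective ha).symm.trans
    ((Submodule.quotEquivOfEq _ _ h).trans (b.quotKerEquivOfSurjective hb)), ?_⟩
  ext z
  have : (a.quotKerEquivOfSurjective ha).symm (a z) = Submodule.Quotient.mk z := by
    rw [LinearEquiv.symm_apply_eq]; rfl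
  simp only [LinearMap.comp_apply, LinearEquiv.coe_coe, LinearEquiv.trans_apply, this]
  rfl

namespace KQVect

variable {K : Type*} [Field K] [Algebra K ℂ]

/-! ### Additive structure on `(K, ℚ)-Vect` -/

section Preadditive

variable {V W : KQVect.{w} K}

@[ext]
lemma hom_ext {f g : V ⟶ W} (h₁ : f.dR = g.dR) (h₂ : f.sing = g.sing) : f = g :=
  Hom.ext h₁ h₂

instance : Zero (V ⟶ W) := ⟨⟨0, 0, by simp⟩⟩

instance : Add (V ⟶ W) := ⟨fun f g => ⟨f.dR + g.dR, f.sing + g.sing, by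
  rw [LinearMap.baseChange_add, LinearMap.baseChange_add, LinearMap.comp_add, LinearMap.add_comp,
    f.comm, g.comm]⟩⟩

instance : Neg (V ⟶ W) := ⟨fun f => ⟨-f.dR, -f.sing, by
  rw [LinearMap.baseChange_neg, LinearMap.baseChange_neg, LinearMap.comp_neg, LinearMap.neg_comp,
    f.comm]⟩⟩

@[simp] lemma zero_dR : (0 : V ⟶ W).dR = 0 := rfl
@[simp] lemma zero_sing : (0 : V ⟶ W).sing = 0 := rfl
@[simp] lemma add_dR (f g : V ⟶ W) : (f + g).dR = f.dR + g.dR := rfl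
@[simp] lemma add_sing (f g : V ⟶ W) : (f + g).sing = f.sing + g.sing := rfl
@[simp] lemma neg_dR (f : V ⟶ W) : (-f).dR = -f.dR := rfl
@[simp] lemma neg_sing (f : V ⟶ W) : (-f).sing = -f.sing := rfl

end Preadditive

@[simp] lemma id_dR (V : KQVect.{w} K) : Hom.dR (𝟙 V) = LinearMap.id := rfl
@[simp] lemma id_sing (V : KQVect.{w} K) : Hom.sing (𝟙 V) = LinearMap.id := rfl
@[simp] lemma comp_dR {U V W : KQVect.{w} K} (f : U ⟶ V) (g : V ⟶ W) :
    (f ≫ g).dR = g.dR ∘ₗ f.dR := rfl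
@[simp] lemma comp_sing {U V W : KQVect.{w} K} (f : U ⟶ V) (g : V ⟶ W) :
    (f ≫ g).sing = g.sing ∘ₗ f.sing := rfl

instance (V W : KQVect.{w} K) : AddCommGroup (V ⟶ W) where
  add_assoc f g h := by ext <;> simp [add_assoc]
  zero_add f := by ext <;> simp
  add_zero f := by ext <;> simp
  nsmul := nsmulRec
  zsmul := zsmulRec
  neg_add_cancel f := by ext <;> simp
  add_comm f g := by ext <;> simp [add_comm]

instance : Preadditive (KQVect.{w} K) where
  add_comp _ _ _ f g h := by ext <;> simp
  comp_add _ _ _ f g h := by ext <;> simp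

section

variable {V W : KQVect.{w} K} (f : V ⟶ W)

lemma Hom.comm_apply (x : ℂ ⊗[K] V.dR) :
    W.comparison (f.dR.baseChange ℂ x) = f.sing.baseChange ℂ (V.comparison x) :=
  LinearMap.congr_fun f.comm x

/-- Faithful flatness of a field extension: `y ↦ 1 ⊗ y` is injective. -/
lemma eq_zero_of_baseChange_eq_zero {k : Type*} [Field k] [Algebra k ℂ] {X Y : Type*}
    [AddCommGroup X] [Module k X] [AddCommGroup Y] [Module k Y] (g : X →ₗ[k] Y)
    (h : g.baseChange ℂ = 0) : g = 0 := by
  ext x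
  have h1 : g.baseChange ℂ (1 ⊗ₜ x) = 0 := by rw [h]; rfl
  rw [LinearMap.baseChange_tmul] at h1
  exact Module.FaithfullyFlat.tensorProduct_mk_injective (A := k) (B := ℂ) Y
    (by simpa using h1)

/-- Over `ℂ` the comparison isomorphisms let either component determine the other; so each
realisation of a faithful `T` is separately faithful. -/
lemma eq_zero_of_sing_eq_zero (h : f.sing = 0) : f = 0 := by
  refine hom_ext (eq_zero_of_baseChange_eq_zero _ ?_) h
  ext x
  apply W.comparison.injective
  have := f.comm_apply (1 ⊗ₜ x)
  rw [h] at this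
  simpa using this

lemma eq_zero_of_dR_eq_zero (h : f.dR = 0) : f = 0 := by
  refine hom_ext h (eq_zero_of_baseChange_eq_zero _ ?_)
  ext x
  have := f.comm_apply (V.comparison.symm (1 ⊗ₜ x))
  rw [h] at this
  simpa using this.symm

/-- The kernel of a morphism, with its inclusion. -/
lemma exists_kernel : ∃ (U : KQVect.{w} K) (i : U ⟶ V), i ≫ f = 0 ∧
    LinearMap.range i.dR = LinearMap.ker f.dR ∧
    LinearMap.range i.sing = LinearMap.ker f.sing := by
  set a := (LinearMap.ker f.dR).subtype.baseChange ℂ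
  set b := (LinearMap.ker f.sing).subtype.baseChange ℂ
  have ha : Function.Injective a := Module.Flat.lTensor_preserves_injective_linearMap _
    (LinearMap.ker f.dR).injective_subtype
  have hb : Function.Injective b := Module.Flat.lTensor_preserves_injective_linearMap _
    (LinearMap.ker f.sing).injective_subtype
  have ea : ∀ x, f.dR.baseChange ℂ x = 0 ↔ x ∈ LinearMap.range a :=
    Module.Flat.lTensor_exact ℂ (LinearMap.exact_subtype_ker_map f.dR)
  have eb : ∀ x, f.sing.baseChange ℂ x = 0 ↔ x ∈ LinearMap.range b :=
    Module.Flat.lTensor_exact ℂ (LinearMap.exact_subtype_ker_map f.sing)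
  -- By flatness `a` and `b` are the kernels of the base-changed components. Compatibility of `f`
  -- with the comparisons makes that of `V` carry one onto the other; the restriction `e` is the
  -- comparison of the kernel.
  obtain ⟨e, he⟩ := LinearMap.exists_equiv_of_range_eq (V.comparison.toLinearMap ∘ₗ a) b
    (V.comparison.injective.comp ha) hb (by
      ext y
      rw [← eb, LinearMap.range_comp, Submodule.mem_map]
      constructor
      · rintro ⟨x, hx, rfl⟩
        rw [LinearEquiv.coe_coe, ← f.comm_apply, (ea x).2 hx, map_zero]
      · intro hy
        refine ⟨V.comparison.symm y, (ea _).1 (W.comparison.injective ?_), by simp⟩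
        rw [f.comm_apply]; simpa using hy)
  refine ⟨⟨LinearMap.ker f.dR, LinearMap.ker f.sing, e⟩,
    ⟨(LinearMap.ker f.dR).subtype, (LinearMap.ker f.sing).subtype, he.symm⟩, ?_, ?_, ?_⟩
  · ext x
    · exact x.2
    · exact x.2
  · exact Submodule.range_subtype _
  · exact Submodule.range_subtype _

/-- The cokernel of a morphism, with its projection. -/
lemma exists_cokernel : ∃ (U : KQVect.{w} K) (p : W ⟶ U), f ≫ p = 0 ∧
    LinearMap.ker p.sing = LinearMap.range f.sing := by
  set a := (LinearMap.range f.dR).mkQ.baseChange ℂ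
  set b := (LinearMap.range f.sing).mkQ.baseChange ℂ
  have ha : Function.Surjective a := LinearMap.lTensor_surjective _ (Submodule.mkQ_surjective _)
  have hb : Function.Surjective b := LinearMap.lTensor_surjective _ (Submodule.mkQ_surjective _)
  have ea : ∀ x, a x = 0 ↔ x ∈ LinearMap.range (f.dR.baseChange ℂ) :=
    lTensor_exact ℂ (LinearMap.exact_map_mkQ_range f.dR) (Submodule.mkQ_surjective _)
  have eb : ∀ x, b x = 0 ↔ x ∈ LinearMap.range (f.sing.baseChange ℂ) :=
    lTensor_exact ℂ (LinearMap.exact_map_mkQ_range f.sing) (Submodule.mkQ_surjective _)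
  -- Dually, right exactness identifies both kernels with images of base-changed components, which
  -- the comparison of `W` matches up.
  obtain ⟨e, he⟩ := LinearMap.exists_equiv_of_ker_eq a (b ∘ₗ W.comparison.toLinearMap)
    ha (hb.comp W.comparison.surjective) (by
      ext y
      rw [LinearMap.mem_ker, LinearMap.mem_ker, ea, LinearMap.comp_apply, eb]
      constructor
      · rintro ⟨x, rfl⟩
        exact ⟨V.comparison x, (f.comm_apply x).symm⟩
      · rintro ⟨x, hx⟩
        refine ⟨V.comparison.symm x, W.comparison.injective ?_⟩
        rw [f.comm_apply]; simpa using hx)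
  refine ⟨⟨W.dR ⧸ LinearMap.range f.dR, W.sing ⧸ LinearMap.range f.sing, e⟩,
    ⟨(LinearMap.range f.dR).mkQ, (LinearMap.range f.sing).mkQ, he⟩, ?_, ?_⟩
  · exact hom_ext (LinearMap.range_mkQ_comp _) (LinearMap.range_mkQ_comp _)
  · exact Submodule.ker_mkQ _

lemma sing_surjective_of_epi [Epi f] : Function.Surjective f.sing := by
  obtain ⟨U, p, hp, hk⟩ := exists_cokernel f
  have : p = 0 := by rw [← cancel_epi f, hp, comp_zero]
  rw [← LinearMap.range_eq_top, ← hk, this]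
  exact LinearMap.ker_zero

end

end KQVect

/-! ### Exact faithful functors to `(K, ℚ)-Vect` -/

section FiberFunctor

open scoped ZeroObject

variable {K : Type*} [Field K] [Algebra K ℂ] {C : Type u} [Category.{v} C] [Abelian C]

/-- A zero morphism factors through the zero object, whose image is terminal; hence its image
factors through a zero morphism. -/
lemma preservesZeroMorphisms_of_preservesFiniteLimits {D : Type*} [Category* D] [Preadditive D]
    (F : C ⥤ D) [PreservesFiniteLimits F] : F.PreservesZeroMorphisms where
  map_zero M N := by
    have hF : IsTerminal (F.obj (0 : C)) :=
      IsTerminal.isTerminalObj F _ (isZero_zero C).isTerminal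
    have h : (0 : M ⟶ N) = (0 : M ⟶ (0 : C)) ≫ (0 : (0 : C) ⟶ N) := by simp
    rw [h, F.map_comp, hF.hom_ext (F.map 0) 0, zero_comp]

/-- The properties of a faithful exact functor to `(K, ℚ)-Vect`, in terms of elements, on which
the comparison of formal periods relies. -/
structure IsFiberFunctor (T : C ⥤ KQVect.{w} K) : Prop where
  map_add_dR {M N : C} (f g : M ⟶ N) : (T.map (f + g)).dR = (T.map f).dR + (T.map g).dR
  map_add_sing {M N : C} (f g : M ⟶ N) : (T.map (f + g)).sing = (T.map f).sing + (T.map g).sing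
  eq_zero_of_dR {M N : C} (f : M ⟶ N) : (T.map f).dR = 0 → f = 0
  eq_zero_of_sing {M N : C} (f : M ⟶ N) : (T.map f).sing = 0 → f = 0
  exists_kernel_dR {M N : C} (f : M ⟶ N) (x : (T.obj M).dR) :
    (T.map f).dR x = 0 → ∃ y, (T.map (kernel.ι f)).dR y = x
  sing_surjective {M N : C} (f : M ⟶ N) [Epi f] : Function.Surjective (T.map f).sing

variable (T : C ⥤ KQVect.{w} K) [PreservesFiniteLimits T]

lemma additive_of_preservesFiniteLimits_KQVect : T.Additive :=
  have := preservesZeroMorphisms_of_preservesFiniteLimits T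
  Functor.additive_of_preserves_binary_products T

lemma exists_lift_kernel_KQVect {M N : C} (f : M ⟶ N) {U : KQVect.{w} K} (i : U ⟶ T.obj M)
    (hi : i ≫ T.map f = 0) : ∃ l, l ≫ T.map (kernel.ι f) = i := by
  have := preservesZeroMorphisms_of_preservesFiniteLimits T
  let h := isLimitForkMapOfIsLimit' T (kernel.condition f) (kernelIsKernel f)
  exact ⟨Fork.IsLimit.lift h i (by rw [hi, comp_zero]), Fork.IsLimit.lift_ι h⟩

/-- The concrete kernel of `T.map f` factors through the image under `T` of the categorical kernel,
because `T` preserves the latter. -/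
lemma exists_kernel_sing_KQVect {M N : C} (f : M ⟶ N) (x : (T.obj M).sing)
    (hx : (T.map f).sing x = 0) : ∃ y, (T.map (kernel.ι f)).sing y = x := by
  obtain ⟨U, i, hi, -, hs⟩ := KQVect.exists_kernel (T.map f)
  obtain ⟨l, rfl⟩ := exists_lift_kernel_KQVect T f i hi
  obtain ⟨y, hy⟩ : x ∈ LinearMap.range (l ≫ T.map (kernel.ι f)).sing := hs ▸ hx
  exact ⟨l.sing y, hy⟩

lemma exists_kernel_dR_KQVect {M N : C} (f : M ⟶ N) (x : (T.obj M).dR)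
    (hx : (T.map f).dR x = 0) : ∃ y, (T.map (kernel.ι f)).dR y = x := by
  obtain ⟨U, i, hi, hs, -⟩ := KQVect.exists_kernel (T.map f)
  obtain ⟨l, rfl⟩ := exists_lift_kernel_KQVect T f i hi
  obtain ⟨y, hy⟩ : x ∈ LinearMap.range (l ≫ T.map (kernel.ι f)).dR := hs ▸ hx
  exact ⟨l.dR y, hy⟩

lemma isFiberFunctor_of_exact [T.Faithful] [PreservesFiniteColimits T] : IsFiberFunctor T := by
  have := additive_of_preservesFiniteLimits_KQVect T
  exact
  { map_add_dR f g := by rw [T.map_add]; rfl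
    map_add_sing f g := by rw [T.map_add]; rfl
    eq_zero_of_dR f h := T.map_injective <| by
      rw [T.map_zero]; exact KQVect.eq_zero_of_dR_eq_zero _ h
    eq_zero_of_sing f h := T.map_injective <| by
      rw [T.map_zero]; exact KQVect.eq_zero_of_sing_eq_zero _ h
    exists_kernel_dR := exists_kernel_dR_KQVect T
    sing_surjective f _ := KQVect.sing_surjective_of_epi _ }

/-- The functor `(V_K, V_ℚ, φ) ↦ (V_ℚ, V_ℚ, id)`. -/
def KQVect.singular : KQVect.{w} K ⥤ KQVect.{w} ℚ where
  obj V := ⟨V.sing, V.sing, LinearEquiv.refl _ _⟩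
  map f := ⟨f.sing, f.sing, rfl⟩

/-- This makes the result on formal periods available for Nori's coalgebra. All properties are
inherited from the singular half of `T`, so exactness of `KQVect.singular` itself is not needed. -/
lemma isFiberFunctor_comp_singular [T.Faithful] [PreservesFiniteColimits T] :
    IsFiberFunctor (T ⋙ KQVect.singular) :=
  have h := isFiberFunctor_of_exact T
  { map_add_dR := h.map_add_sing
    map_add_sing := h.map_add_sing
    eq_zero_of_dR := h.eq_zero_of_sing
    eq_zero_of_sing := h.eq_zero_of_sing
    exists_kernel_dR := exists_kernel_sing_KQVect T
    sing_surjective := h.sing_surjective }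

end FiberFunctor

/-! ### Vanishing of a formal period -/

lemma ModuleCat.exists_filtered_colimit {J : Type u} [Category.{v} J] [IsFiltered J]
    (G : J ⥤ ModuleCat.{w} ℚ) :
    ∃ (L : Type (max u v w)) (_ : AddCommGroup L) (_ : Module ℚ L)
      (a : ∀ j, G.obj j →ₗ[ℚ] L), (∀ {j k : J} (f : j ⟶ k) (x : G.obj j),
        a k ((G.map f).hom x) = a j x) ∧
      ∀ (j : J) (x : G.obj j), a j x = 0 → ∃ (k : J) (f : j ⟶ k), (G.map f).hom x = 0 := by
  -- Indices and values are lifted to a common universe, where the explicit filtered colimit of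
  -- modules lives.
  let F : AsSmall.{max u v w} J ⥤ ModuleCat.{max u v w} ℚ :=
    AsSmall.down ⋙ G ⋙ ModuleCat.uliftFunctor.{max u v w} ℚ
  refine ⟨FilteredColimits.colimit F, inferInstance, inferInstance,
    fun j => (FilteredColimits.coconeMorphism F (AsSmall.up.obj j)).hom ∘ₗ
      ULift.moduleEquiv.symm.toLinearMap, fun f x => ?_, fun j x hx => ?_⟩
  · exact FilteredColimits.M.mk_map F (AsSmall.up.map f) (ULift.up x)
  · have h : FilteredColimits.M.mk F ⟨AsSmall.up.obj j, ULift.up x⟩ =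
        FilteredColimits.M.mk F ⟨AsSmall.up.obj j, 0⟩ :=
      hx.trans (FilteredColimits.colimit_zero_eq F _)
    -- The arrow `g` applied to `0` may differ from `f`, which is harmless since it sends `0` to
    -- `0`.
    obtain ⟨k, f, g, h⟩ := (Functor.ιColimitType_eq_iff_of_isFiltered _ _ _).1 h
    refine ⟨AsSmall.down.obj k, AsSmall.down.map f, (congrArg ULift.down h).trans ?_⟩
    exact map_zero (G.map (AsSmall.down.map g)).hom

section Vanishing

open scoped ZeroObject

variable {K : Type*} [Field K] [Algebra K ℂ] {C : Type u} [Category.{v} C]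

/-- An object `M` of `C` with a vector in `T(M)_K`. -/
structure PointedObject (T : C ⥤ KQVect.{w} K) where
  /-- the object -/
  obj : C
  /-- the vector -/
  pt : (T.obj obj).dR

namespace PointedObject

instance (T : C ⥤ KQVect.{w} K) : Category (PointedObject T) where
  Hom X Y := {f : X.obj ⟶ Y.obj // (T.map f).dR X.pt = Y.pt}
  id X := ⟨𝟙 X.obj, by rw [T.map_id]; rfl⟩
  comp f g := ⟨f.1 ≫ g.1, by rw [T.map_comp, KQVect.comp_dR, LinearMap.comp_apply, f.2, g.2]⟩

/-- The functor `(M, ω) ↦ T(M)_ℚ^∨`. -/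
def dualFunctor (T : C ⥤ KQVect.{w} K) : (PointedObject T)ᵒᵖ ⥤ ModuleCat.{w} ℚ where
  obj X := .of ℚ (Module.Dual ℚ (T.obj X.unop.obj).sing)
  map f := ModuleCat.ofHom (T.map f.unop.1).sing.dualMap
  map_id X := by
    ext σ x
    change σ ((T.map (𝟙 X.unop.obj)).sing x) = σ x
    rw [T.map_id]; rfl
  map_comp f g := by
    ext σ x
    change σ ((T.map (g.unop.1 ≫ f.unop.1)).sing x) = _
    rw [T.map_comp]; rfl

end PointedObject

namespace IsFiberFunctor

variable [Abelian C] {T : C ⥤ KQVect.{w} K}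

lemma map_zero_dR (hT : IsFiberFunctor T) (M N : C) : (T.map (0 : M ⟶ N)).dR = 0 := by
  have := hT.map_add_dR (0 : M ⟶ N) 0
  rwa [add_zero, left_eq_add] at this

lemma map_zero_sing (hT : IsFiberFunctor T) (M N : C) : (T.map (0 : M ⟶ N)).sing = 0 := by
  have := hT.map_add_sing (0 : M ⟶ N) 0
  rwa [add_zero, left_eq_add] at this

lemma exists_biprod_dR (hT : IsFiberFunctor T) (M N : C) (x : (T.obj M).dR)
    (y : (T.obj N).dR) :
    ∃ z, (T.map (biprod.fst : M ⊞ N ⟶ M)).dR z = x ∧ (T.map (biprod.snd : M ⊞ N ⟶ N)).dR z = y := by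
  have key {A B D : C} (f : A ⟶ B) (g : B ⟶ D) (x) :
      (T.map g).dR ((T.map f).dR x) = (T.map (f ≫ g)).dR x := by
    rw [T.map_comp]; rfl
  refine ⟨(T.map biprod.inl).dR x + (T.map biprod.inr).dR y, ?_, ?_⟩
  · simp [key, hT.map_zero_dR]
  · simp [key, hT.map_zero_dR]

/-- Two pointed objects are dominated by their biproduct. Two parallel morphisms agree on the kernel
of their difference, to which the base vector lifts since both send it to the same vector. -/
lemma isCofiltered_pointedObject (hT : IsFiberFunctor T) : IsCofiltered (PointedObject T) where
  cone_objs X Y := by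
    obtain ⟨z, hx, hy⟩ := hT.exists_biprod_dR X.obj Y.obj X.pt Y.pt
    exact ⟨⟨X.obj ⊞ Y.obj, z⟩, ⟨biprod.fst, hx⟩, ⟨biprod.snd, hy⟩, trivial⟩
  cone_maps X Y f g := by
    obtain ⟨y, hy⟩ := hT.exists_kernel_dR (f.1 - g.1) X.pt (by
      have := hT.map_add_dR (f.1 - g.1) g.1
      rw [sub_add_cancel] at this
      have h := LinearMap.congr_fun this X.pt
      rw [LinearMap.add_apply, f.2, g.2, right_eq_add] at h
      exact h)
    refine ⟨⟨kernel (f.1 - g.1), y⟩, ⟨kernel.ι _, hy⟩, Subtype.ext ?_⟩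
    have := kernel.condition (f.1 - g.1)
    rwa [Preadditive.comp_sub, sub_eq_zero] at this
  nonempty := ⟨⟨0, 0⟩⟩

variable [Linear ℚ C]

/-- Additivity suffices: additive maps between rational vector spaces are `ℚ`-linear. -/
lemma map_rat_smul_dR (hT : IsFiberFunctor T) {M N : C} (q : ℚ) (f : M ⟶ N) (x : (T.obj M).dR) :
    (T.map (q • f)).dR x = (q : K) • (T.map f).dR x :=
  map_ratCast_smul (AddMonoidHom.mk' (fun f : M ⟶ N => (T.map f).dR x) fun f g => by
    rw [hT.map_add_dR]; rfl) ℚ K q f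

lemma map_rat_smul_sing (hT : IsFiberFunctor T) {M N : C} (q : ℚ) (f : M ⟶ N)
    (x : (T.obj M).sing) :
    (T.map (q • f)).sing x = q • (T.map f).sing x :=
  map_rat_smul (AddMonoidHom.mk' (fun f : M ⟶ N => (T.map f).sing x) fun f g => by
    rw [hT.map_add_sing]; rfl) q f

/-- If the class of `(M, σ, ω)` vanishes, then `ω` comes from a morphism to `M` on whose source
`σ` vanishes. -/
lemma exists_of_periodGenerator_mem (hT : IsFiberFunctor T) {M : C}
    {σ : Module.Dual ℚ (T.obj M).sing} {ω : (T.obj M).dR}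
    (h : periodGenerator T M σ ω ∈ periodRelations T) :
    ∃ (N : C) (f : N ⟶ M) (n : (T.obj N).dR), (T.map f).dR n = ω ∧ σ ∘ₗ (T.map f).sing = 0 := by
  have := hT.isCofiltered_pointedObject
  obtain ⟨L, _, _, a, ha, hker⟩ := ModuleCat.exists_filtered_colimit (PointedObject.dualFunctor T)
  have ha' : ∀ {M N : C} (f : M ⟶ N) (ω : (T.obj M).dR) (η : (T.obj N).dR)
      (σ : Module.Dual ℚ (T.obj N).sing), (T.map f).dR ω = η →
      a (.op ⟨N, η⟩) σ = a (.op ⟨M, ω⟩) (σ ∘ₗ (T.map f).sing) := fun {M N} f ω η σ hf =>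
    (ha (j := .op ⟨N, η⟩) (k := .op ⟨M, ω⟩) (Quiver.Hom.op ⟨f, hf⟩) σ).symm
  -- `Φ` sends a symbol to the element of the colimit represented by `σ` at the stage `(M, ω)`.
  let Φ : (PeriodSymbol T →₀ ℚ) →ₗ[ℚ] L :=
    Finsupp.linearCombination ℚ fun s => a (.op ⟨s.obj, s.omega⟩) s.sigma
  have hΦ : ∀ M σ ω, Φ (periodGenerator T M σ ω) = a (.op ⟨M, ω⟩) σ := fun M σ ω => by
    simp [Φ, periodGenerator]
  have hle : periodRelations T ≤ LinearMap.ker Φ := by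
    refine Submodule.span_le.2 ?_
    rintro _ (⟨M, σ, τ, ω⟩ | ⟨M, q, σ, ω⟩ | ⟨M, σ, ω, η⟩ | ⟨M, q, σ, ω⟩ | ⟨f, σ, ω⟩) <;>
      simp only [SetLike.mem_coe, LinearMap.mem_ker, map_sub, map_add, map_smul, hΦ, sub_eq_zero]
    · exact map_add (a _) _ _
    · exact map_smul (a _) _ _
    -- Additivity in `ω` is not built into the colimit. All three terms are pulled back to one
    -- vector `z` of `M ⊞ M`, along `fst + snd`, `fst` and `snd`.
    · obtain ⟨z, h₁, h₂⟩ := hT.exists_biprod_dR M M ω η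
      rw [ha' (biprod.fst + biprod.snd : M ⊞ M ⟶ M) z (ω + η) σ
          (by rw [hT.map_add_dR, LinearMap.add_apply, h₁, h₂]),
        ha' (biprod.fst : M ⊞ M ⟶ M) z ω σ h₁, ha' (biprod.snd : M ⊞ M ⟶ M) z η σ h₂,
        hT.map_add_sing, LinearMap.comp_add]
      exact map_add (a _) _ _
    -- Scaling `ω` is functoriality along the endomorphism `q • 𝟙 M`.
    · rw [ha' (q • 𝟙 M) ω ((q : K) • ω) σ (by rw [hT.map_rat_smul_dR, T.map_id]; rfl)]
      have : σ ∘ₗ (T.map (q • 𝟙 M)).sing = q • σ := by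
        ext x
        rw [LinearMap.comp_apply, hT.map_rat_smul_sing, T.map_id]
        exact map_smul σ q x
      rw [this]
      exact map_smul (a _) _ _
    · exact (ha' f ω _ σ rfl).symm
  obtain ⟨k, f, hf⟩ := hker (.op ⟨M, ω⟩) σ (by rw [← hΦ]; exact hle h)
  exact ⟨k.unop.obj, f.unop.1, k.unop.pt, f.unop.2, hf⟩

end IsFiberFunctor

end Vanishing

/-! ### Formal periods and subquotients -/

namespace FormalPeriods

variable {K : Type*} [Field K] [Algebra K ℂ] {C : Type u} [Category.{v} C] (T : C ⥤ KQVect.{w} K)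

/-- The class of the symbol `(M, σ, ω)`. -/
def mk (M : C) (σ : Module.Dual ℚ (T.obj M).sing) (ω : (T.obj M).dR) : FormalPeriods T :=
  (periodRelations T).mkQ (periodGenerator T M σ ω)

lemma mkQ_eq_zero {x : PeriodSymbol T →₀ ℚ} (h : IsPeriodRelation T x) :
    (periodRelations T).mkQ x = 0 :=
  (Submodule.Quotient.mk_eq_zero _).2 (Submodule.subset_span h)

lemma mk_add_sigma (M : C) (σ τ : Module.Dual ℚ (T.obj M).sing) (ω : (T.obj M).dR) :
    mk T M (σ + τ) ω = mk T M σ ω + mk T M τ ω := by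
  have h := mkQ_eq_zero T (.add_sigma M σ τ ω)
  rw [map_sub, map_add] at h
  exact sub_eq_zero.1 h

lemma mk_smul_sigma (M : C) (q : ℚ) (σ : Module.Dual ℚ (T.obj M).sing) (ω : (T.obj M).dR) :
    mk T M (q • σ) ω = q • mk T M σ ω := by
  have h := mkQ_eq_zero T (.smul_sigma M q σ ω)
  rw [map_sub, map_smul] at h
  exact sub_eq_zero.1 h

lemma mk_add_omega (M : C) (σ : Module.Dual ℚ (T.obj M).sing) (ω η : (T.obj M).dR) :
    mk T M σ (ω + η) = mk T M σ ω + mk T M σ η := by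
  have h := mkQ_eq_zero T (.add_omega M σ ω η)
  rw [map_sub, map_add] at h
  exact sub_eq_zero.1 h

lemma mk_smul_omega (M : C) (q : ℚ) (σ : Module.Dual ℚ (T.obj M).sing) (ω : (T.obj M).dR) :
    mk T M σ ((q : K) • ω) = q • mk T M σ ω := by
  have h := mkQ_eq_zero T (.smul_omega M q σ ω)
  rw [map_sub, map_smul] at h
  exact sub_eq_zero.1 h

lemma mk_map {M N : C} (f : M ⟶ N) (σ : Module.Dual ℚ (T.obj N).sing) (ω : (T.obj M).dR) :
    mk T N σ ((T.map f).dR ω) = mk T M (σ ∘ₗ (T.map f).sing) ω := by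
  have h := mkQ_eq_zero T (.functoriality f σ ω)
  rw [map_sub] at h
  exact (sub_eq_zero.1 h).symm

lemma mk_zero (M : C) (ω : (T.obj M).dR) : mk T M 0 ω = 0 := by
  simpa using mk_smul_sigma T M 0 0 ω

lemma map_mk {C' : Type u'} [Category.{v'} C'] (ι : C' ⥤ C) (M : C')
    (σ : Module.Dual ℚ (T.obj (ι.obj M)).sing) (ω : (T.obj (ι.obj M)).dR) :
    map T ι (mk (ι ⋙ T) M σ ω) = mk T (ι.obj M) σ ω := by
  refine congrArg (periodRelations T).mkQ ?_
  rw [Finsupp.lmapDomain_apply, Finsupp.mapDomain_single]; rfl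

end FormalPeriods

namespace IsFiberFunctor

open scoped ZeroObject

variable {K : Type*} [Field K] [Algebra K ℂ] {C : Type u} [Category.{v} C] [Abelian C]
  {T : C ⥤ KQVect.{w} K}

/-- Two symbols add up to one on the biproduct: include the vectors, project the forms, and the
cross terms vanish. -/
lemma exists_eq_mk (hT : IsFiberFunctor T) (x : FormalPeriods T) :
    ∃ (M : C) (σ : Module.Dual ℚ (T.obj M).sing) (ω : (T.obj M).dR),
      FormalPeriods.mk T M σ ω = x := by
  obtain ⟨x, rfl⟩ := Submodule.mkQ_surjective _ x
  induction x using Finsupp.induction_linear with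
  | zero => exact ⟨0, 0, 0, by rw [FormalPeriods.mk_zero, map_zero]⟩
  | single s q =>
    refine ⟨s.obj, q • s.sigma, s.omega, ?_⟩
    rw [FormalPeriods.mk_smul_sigma, FormalPeriods.mk, ← map_smul, periodGenerator,
      Finsupp.smul_single_one]
  | add x y hx hy =>
    obtain ⟨M, σ, ω, hx⟩ := hx
    obtain ⟨N, τ, η, hy⟩ := hy
    refine ⟨M ⊞ N, σ ∘ₗ (T.map biprod.fst).sing + τ ∘ₗ (T.map biprod.snd).sing,
      (T.map biprod.inl).dR ω + (T.map biprod.inr).dR η, ?_⟩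
    have key {A B D : C} (f : A ⟶ B) (g : B ⟶ D) :
        (T.map g).sing ∘ₗ (T.map f).sing = (T.map (f ≫ g)).sing := by
      rw [T.map_comp]; rfl
    rw [FormalPeriods.mk_add_omega, FormalPeriods.mk_map, FormalPeriods.mk_map, map_add, ← hx,
      ← hy]
    simp only [LinearMap.add_comp, LinearMap.comp_assoc, key, biprod.inl_fst, biprod.inl_snd,
      biprod.inr_fst, biprod.inr_snd, hT.map_zero_sing, T.map_id, KQVect.id_sing,
      LinearMap.comp_id, LinearMap.comp_zero, add_zero, zero_add]

end IsFiberFunctor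

section Subquotients

open scoped ZeroObject

variable {C : Type u} [Category.{v} C] [Abelian C]

lemma exists_factor_of_comp_cokernel_eq_zero {A B Z : C} (a : A ⟶ Z) (b : B ⟶ Z) [Mono b]
    (h : a ≫ cokernel.π b = 0) : ∃ l, l ≫ b = a :=
  ⟨_, (KernelFork.IsLimit.lift' (Abelian.monoIsKernelOfCokernel _ (cokernelIsCokernel b)) a
    h).2⟩

lemma exists_factor_of_kernel_comp_eq_zero {A B Z : C} (a : Z ⟶ A) (b : Z ⟶ B) [Epi b]
    (h : kernel.ι b ≫ a = 0) : ∃ l, b ≫ l = a :=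
  ⟨_, (CokernelCofork.IsColimit.desc' (Abelian.epiIsCokernelOfKernel _ (kernelIsKernel b)) a
    h).2⟩

variable {C' : Type u'} [Category.{v'} C'] [Abelian C'] {ι : C' ⥤ C}

/-- A quotient is the cokernel of its kernel. The kernel comes from some `j` in `C'`, and `ι`
preserves the cokernel of `j`. -/
lemma closedUnderSubquotients_of_sub [PreservesFiniteLimits ι] [PreservesFiniteColimits ι]
    (h : ∀ (X : C') (Y : C) (i : Y ⟶ ι.obj X), Mono i →
      ∃ (Y' : C') (j : Y' ⟶ X) (e : ι.obj Y' ≅ Y), e.hom ≫ i = ι.map j) :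
    ClosedUnderSubquotients ι where
  sub := h
  quot X Y p hp := by
    have := preservesZeroMorphisms_of_preservesFiniteLimits ι
    obtain ⟨Z, j, e, he⟩ := h X _ (kernel.ι p) inferInstance
    have hq := isColimitCoforkMapOfIsColimit' ι (cokernel.condition j) (cokernelIsCokernel j)
    have hjp : ι.map j ≫ p = 0 := by rw [← he, Category.assoc, kernel.condition, comp_zero]
    obtain ⟨m, hm⟩ := CokernelCofork.IsColimit.desc' hq p hjp
    change ι.map (cokernel.π j) ≫ m = p at hm
    obtain ⟨l, hl⟩ := exists_factor_of_kernel_comp_eq_zero (ι.map (cokernel.π j)) p (by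
      rw [(Iso.eq_inv_comp e).2 he, Category.assoc, ← ι.map_comp, cokernel.condition,
        ι.map_zero, comp_zero])
    refine ⟨cokernel j, cokernel.π j, ⟨m, l, ?_, ?_⟩, hm⟩
    · rw [← cancel_epi (ι.map (cokernel.π j)), reassoc_of% hm, hl, Category.comp_id]
    · rw [← cancel_epi p, reassoc_of% hl, hm, Category.comp_id]

variable {K : Type*} [Field K] [Algebra K ℂ] {T : C ⥤ KQVect.{w} K}

lemma ClosedUnderSubquotients.injective_formalPeriods_map (hT : IsFiberFunctor T)
    (hT' : IsFiberFunctor (ι ⋙ T)) [Linear ℚ C] (h : ClosedUnderSubquotients ι) :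
    Function.Injective (FormalPeriods.map T ι) := by
  rw [injective_iff_map_eq_zero]
  intro x hx
  obtain ⟨M, σ, ω, rfl⟩ := hT'.exists_eq_mk x
  erw [FormalPeriods.map_mk] at hx
  obtain ⟨N, f, n, rfl, hσ⟩ :=
    hT.exists_of_periodGenerator_mem ((Submodule.Quotient.mk_eq_zero _).1 hx)
  -- The witness `f` need not come from `C'`, but its image does. The vector lifts to this image,
  -- and `σ` vanishes on all of it because epimorphisms are surjective on singular realisations.
  obtain ⟨Y, j, e, he⟩ := h.sub M _ (image.ι f) inferInstance
  have hj : (factorThruImage f ≫ e.inv) ≫ ι.map j = f := by simp [← he]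
  have h₁ : (T.map f).dR n = ((ι ⋙ T).map j).dR ((T.map (factorThruImage f ≫ e.inv)).dR n) := by
    nth_rw 1 [← hj]
    rw [T.map_comp]; rfl
  have h₂ : σ ∘ₗ ((ι ⋙ T).map j).sing = 0 := by
    refine LinearMap.ext fun x => ?_
    obtain ⟨y, rfl⟩ := hT.sing_surjective (factorThruImage f ≫ e.inv) x
    have := LinearMap.congr_fun hσ y
    rw [← hj, T.map_comp] at this
    exact this
  rw [h₁, FormalPeriods.mk_map, h₂, FormalPeriods.mk_zero]

section

variable [Linear ℚ C']

/-- The vector is fixed while the source shrinks: each form on the cokernel gives a symbol that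
vanishes over `C`, hence over `C'`, and the witness in `C'` kills that form. Finitely many forms
span the dual, and the singular realisation is faithful. -/
lemma exists_sub_of_mem_range (hT : IsFiberFunctor T) (hT' : IsFiberFunctor (ι ⋙ T))
    (h : Function.Injective (FormalPeriods.map T ι))
    {X : C'} {Y : C} (i : Y ⟶ ι.obj X) (y : (T.obj Y).dR) :
    ∃ (Y' : C') (g : Y' ⟶ X) (n : (T.obj (ι.obj Y')).dR), (T.map (ι.map g)).dR n = (T.map i).dR y ∧
      ι.map g ≫ cokernel.π i = 0 := by
  obtain ⟨F, hF⟩ := Module.Finite.fg_top (R := ℚ)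
    (M := Module.Dual ℚ (T.obj (cokernel i)).sing)
  have key : ∀ F : Finset (Module.Dual ℚ (T.obj (cokernel i)).sing),
      ∃ (Y' : C') (g : Y' ⟶ X) (n : (T.obj (ι.obj Y')).dR),
        (T.map (ι.map g)).dR n = (T.map i).dR y ∧
        ∀ τ ∈ F, τ ∘ₗ (T.map (ι.map g ≫ cokernel.π i)).sing = 0 := by
    classical
    intro F
    induction F using Finset.induction_on with
    | empty => exact ⟨X, 𝟙 X, (T.map i).dR y, by rw [ι.map_id, T.map_id]; rfl, by simp⟩
    | insert τ F _ ih =>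
      obtain ⟨Z, g, n, hn, hg⟩ := ih
      -- The new symbol lives on the current `Z`, not on `X`, so its witness `W ⟶ Z` keeps the forms
      -- killed earlier dead.
      have hz : FormalPeriods.mk (ι ⋙ T) Z (τ ∘ₗ (T.map (ι.map g ≫ cokernel.π i)).sing) n = 0 := by
        refine h ?_
        erw [FormalPeriods.map_mk]
        rw [← FormalPeriods.mk_map, T.map_comp, KQVect.comp_dR, LinearMap.comp_apply, hn,
          ← LinearMap.comp_apply, ← KQVect.comp_dR, ← T.map_comp, FormalPeriods.mk_map,
          cokernel.condition, hT.map_zero_sing, LinearMap.comp_zero, FormalPeriods.mk_zero,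
          map_zero]
      obtain ⟨W, f, m, hm, hf⟩ :=
        hT'.exists_of_periodGenerator_mem ((Submodule.Quotient.mk_eq_zero _).1 hz)
      have hc : ∀ τ : Module.Dual ℚ (T.obj (cokernel i)).sing,
          τ ∘ₗ (T.map (ι.map (f ≫ g) ≫ cokernel.π i)).sing =
            (τ ∘ₗ (T.map (ι.map g ≫ cokernel.π i)).sing) ∘ₗ ((ι ⋙ T).map f).sing := by
        intro τ
        rw [ι.map_comp, Category.assoc, T.map_comp]; rfl
      refine ⟨W, f ≫ g, m, ?_, ?_⟩
      · rw [← hn, ← hm, ι.map_comp, T.map_comp]; rfl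
      · intro τ' hτ'
        rw [hc]
        rcases Finset.mem_insert.1 hτ' with rfl | hτ'
        · exact hf
        · rw [hg τ' hτ', LinearMap.zero_comp]
  obtain ⟨Z, g, n, hn, hg⟩ := key F
  refine ⟨Z, g, n, hn, hT.eq_zero_of_sing _ ?_⟩
  ext x
  rw [LinearMap.zero_apply, ← Module.forall_dual_apply_eq_zero_iff ℚ]
  intro τ
  have hτ : τ ∈ Submodule.span ℚ (F : Set _) := hF ▸ Submodule.mem_top
  induction hτ using Submodule.span_induction with
  | mem τ hτ => exact LinearMap.congr_fun (hg τ hτ) x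
  | zero => rfl
  | add a b _ _ ha hb => rw [LinearMap.add_apply, ha, hb, add_zero]
  | smul q a _ ha => rw [LinearMap.smul_apply, ha, smul_zero]

/-- The two vanishing composites say that `ι.map g` and `i` have the same image. Biproducts collect
morphisms hitting each vector of a finite generating set of `T(Y)_K`; faithfulness on the de Rham
side gives the second equation. -/
lemma exists_sub_of_injective [PreservesFiniteLimits ι]
    (hT : IsFiberFunctor T) (hT' : IsFiberFunctor (ι ⋙ T))
    (h : Function.Injective (FormalPeriods.map T ι))
    {X : C'} {Y : C} (i : Y ⟶ ι.obj X) :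
    ∃ (Y' : C') (g : Y' ⟶ X), ι.map g ≫ cokernel.π i = 0 ∧ i ≫ cokernel.π (ι.map g) = 0 := by
  have := preservesZeroMorphisms_of_preservesFiniteLimits ι
  obtain ⟨F, hF⟩ := Module.Finite.fg_top (R := K) (M := (T.obj Y).dR)
  have key : ∀ F : Finset (T.obj Y).dR, ∃ (Y' : C') (g : Y' ⟶ X), ι.map g ≫ cokernel.π i = 0 ∧
      ∀ y ∈ F, (T.map i).dR y ∈ LinearMap.range (T.map (ι.map g)).dR := by
    classical
    intro F
    induction F using Finset.induction_on with
    | empty => exact ⟨0, 0, by simp, by simp⟩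
    | insert y F _ ih =>
      obtain ⟨Z, g, h₁, h₂⟩ := ih
      obtain ⟨Z', g', n, hn, h₃⟩ := exists_sub_of_mem_range hT hT' h i y
      have hl : ∀ {A B D : C'} (f : A ⟶ B) (g : B ⟶ D), LinearMap.range (T.map (ι.map (f ≫ g))).dR ≤
          LinearMap.range (T.map (ι.map g)).dR := by
        intro A B D f g
        rw [ι.map_comp, T.map_comp]
        exact LinearMap.range_comp_le_range _ _
      refine ⟨Z ⊞ Z', biprod.desc g g', ?_, fun y' hy' => ?_⟩
      · have := ι.additive_of_preserves_binary_products
        rw [biprod.desc_eq, ι.map_add, ι.map_comp, ι.map_comp, Preadditive.add_comp,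
          Category.assoc, Category.assoc, h₁, h₃, comp_zero, comp_zero, add_zero]
      · rcases Finset.mem_insert.1 hy' with rfl | hy'
        · have := hl biprod.inr (biprod.desc g g')
          rw [biprod.inr_desc] at this
          exact this ⟨n, hn⟩
        · have := hl biprod.inl (biprod.desc g g')
          rw [biprod.inl_desc] at this
          exact this (h₂ y' hy')
  obtain ⟨Z, g, h₁, h₂⟩ := key F
  refine ⟨Z, g, h₁, hT.eq_zero_of_dR _ ?_⟩
  have hc : (T.map (cokernel.π (ι.map g))).dR ∘ₗ (T.map (ι.map g)).dR = 0 := by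
    rw [← KQVect.comp_dR, ← T.map_comp, cokernel.condition, hT.map_zero_dR]
  refine LinearMap.ext_on hF fun y hy => ?_
  obtain ⟨n, hn⟩ := h₂ y hy
  rw [T.map_comp, KQVect.comp_dR, LinearMap.comp_apply, ← hn]
  exact LinearMap.congr_fun hc n

/-- Replacing `g` by its image in `C'` gives a monomorphism that `ι` preserves; it and `i` then
factor through each other. -/
lemma closedUnderSubquotients_of_injective [PreservesFiniteLimits ι]
    [PreservesFiniteColimits ι] (hT : IsFiberFunctor T) (hT' : IsFiberFunctor (ι ⋙ T))
    (h : Function.Injective (FormalPeriods.map T ι)) : ClosedUnderSubquotients ι := by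
  refine closedUnderSubquotients_of_sub fun X Y i hi => ?_
  obtain ⟨Z, g, h₁, h₂⟩ := exists_sub_of_injective hT hT' h i
  have hg : ι.map (factorThruImage g) ≫ ι.map (image.ι g) = ι.map g := by
    rw [← ι.map_comp, image.fac]
  obtain ⟨l, hl⟩ := exists_factor_of_comp_cokernel_eq_zero (ι.map (image.ι g)) i (by
    rw [← cancel_epi (ι.map (factorThruImage g)), reassoc_of% hg, h₁, comp_zero])
  obtain ⟨m, hm⟩ := exists_factor_of_comp_cokernel_eq_zero i (ι.map (image.ι g)) (by
    rw [← cokernel.π_desc (ι.map g) (cokernel.π (ι.map (image.ι g)))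
      (by rw [← hg, Category.assoc, cokernel.condition, comp_zero]), reassoc_of% h₂, zero_comp])
  refine ⟨image g, image.ι g, ⟨l, m, ?_, ?_⟩, hl⟩
  · rw [← cancel_mono (ι.map (image.ι g)), Category.assoc, hm, hl, Category.id_comp]
  · rw [← cancel_mono i, Category.assoc, hl, hm, Category.id_comp]

end

theorem closedUnderSubquotients_iff_injective_formalPeriods_map [Linear ℚ C] [Linear ℚ C']
    [PreservesFiniteLimits ι] [PreservesFiniteColimits ι]
    (hT : IsFiberFunctor T) (hT' : IsFiberFunctor (ι ⋙ T)) :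
    ClosedUnderSubquotients ι ↔ Function.Injective (FormalPeriods.map T ι) :=
  ⟨fun h => h.injective_formalPeriods_map hT hT',
    fun h => closedUnderSubquotients_of_injective hT hT' h⟩

end Subquotients

/-! ### Nori's coalgebra as a space of formal periods -/

section Nori

/-- The linear form `h ↦ σ (h v)` on a space of linear maps. -/
def matrixCoefficient {V W : Type*} [AddCommGroup V] [Module ℚ V] [AddCommGroup W] [Module ℚ W]
    (σ : Module.Dual ℚ W) (v : V) : Module.Dual ℚ (V →ₗ[ℚ] W) :=
  σ ∘ₗ LinearMap.applyₗ v

/-- Expand `h` as the sum of the rank one maps `x ↦ b.coord i x • h (b i)` and apply `l`; matrix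
coefficients therefore span the dual. -/
lemma eq_sum_matrixCoefficient {V W n : Type*} [AddCommGroup V] [Module ℚ V] [AddCommGroup W]
    [Module ℚ W] [Fintype n] (b : Module.Basis n ℚ V) (l : Module.Dual ℚ (V →ₗ[ℚ] W)) :
    l = ∑ i, matrixCoefficient (l ∘ₗ LinearMap.smulRightₗ (b.coord i)) (b i) := by
  classical
  ext h
  have hh : h = ∑ i, (b.coord i).smulRight (h (b i)) := by
    refine b.ext fun j => ?_
    simp [LinearMap.sum_apply, Finsupp.single_apply, ite_smul]
  rw [LinearMap.sum_apply]
  nth_rw 1 [hh]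
  rw [map_sum]
  rfl

variable {K : Type*} [Field K] [Algebra K ℂ] {C : Type u} [Category.{v} C] (T : C ⥤ KQVect.{w} K)

namespace FormalPeriods

/-- The map from the formal periods of `M ↦ (T(M)_ℚ, T(M)_ℚ, id)` to Nori's coalgebra sending
`(M, σ, v)` to the linear form `a ↦ σ (a v)` on `End(T(M)_ℚ)`. -/
def toNori : FormalPeriods (T ⋙ KQVect.singular) →ₗ[ℚ] NoriCoalgebra T :=
  (periodRelations (T ⋙ KQVect.singular)).liftQ
    (Finsupp.linearCombination ℚ fun s : PeriodSymbol (T ⋙ KQVect.singular) =>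
      NoriCoalgebra.of T s.obj (matrixCoefficient (V := (T.obj s.obj).sing)
        (W := (T.obj s.obj).sing) s.sigma s.omega)) <| by
    refine Submodule.span_le.2 ?_
    rintro _ (⟨M, σ, τ, ω⟩ | ⟨M, q, σ, ω⟩ | ⟨M, σ, ω, η⟩ | ⟨M, q, σ, ω⟩ | @⟨M, N, f, σ, ω⟩) <;>
      simp only [SetLike.mem_coe, LinearMap.mem_ker, map_sub, map_add, map_smul, sub_eq_zero,
        periodGenerator, Finsupp.linearCombination_single, one_smul]
    · rw [← map_add]
      rfl
    · rw [← map_smul]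
      rfl
    · rw [← map_add]
      refine congrArg _ (LinearMap.ext fun a => ?_)
      exact (congrArg σ (map_add a ω η)).trans (map_add σ _ _)
    · rw [← map_smul]
      refine congrArg _ (LinearMap.ext fun a => ?_)
      exact (congrArg σ (map_smul a q ω)).trans (map_smul σ _ _)
    · exact LinearMap.congr_fun (NoriCoalgebra.of_comp_ofSource T f)
        (matrixCoefficient (V := (T.obj M).sing) (W := (T.obj N).sing) σ ω)

/-- The class of `(M, σ, v)` for `σ ∈ T(M)_ℚ^∨` and `v ∈ T(M)_ℚ`. -/
abbrev mkSing (M : C) (σ : Module.Dual ℚ (T.obj M).sing) (v : (T.obj M).sing) :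
    FormalPeriods (T ⋙ KQVect.singular) :=
  mk (T ⋙ KQVect.singular) M σ v

lemma mkSing_add (M : C) (σ τ : Module.Dual ℚ (T.obj M).sing) (v : (T.obj M).sing) :
    mkSing T M (σ + τ) v = mkSing T M σ v + mkSing T M τ v :=
  mk_add_sigma (T ⋙ KQVect.singular) M σ τ v

lemma mkSing_smul (M : C) (q : ℚ) (σ : Module.Dual ℚ (T.obj M).sing) (v : (T.obj M).sing) :
    mkSing T M (q • σ) v = q • mkSing T M σ v :=
  mk_smul_sigma (T ⋙ KQVect.singular) M q σ v

lemma toNori_mkSing (M : C) (σ : Module.Dual ℚ (T.obj M).sing) (v : (T.obj M).sing) :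
    toNori T (mkSing T M σ v) =
      NoriCoalgebra.of T M (matrixCoefficient σ v) := by
  exact (Finsupp.linearCombination_single _ _ _).trans (one_smul _ _)

lemma toNori_surjective : Function.Surjective (toNori T) := by
  classical
  rw [← LinearMap.range_eq_top, eq_top_iff]
  rintro x -
  obtain ⟨x, rfl⟩ := Submodule.mkQ_surjective _ x
  induction x using DFinsupp.induction with
  | h0 => rw [map_zero]; exact zero_mem _
  | ha M l x _ _ hx =>
    rw [map_add]
    refine add_mem ?_ hx
    change NoriCoalgebra.of T M l ∈ _
    rw [eq_sum_matrixCoefficient (Module.finBasis ℚ (T.obj M).sing) l, map_sum]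
    exact sum_mem fun i _ => ⟨_, toNori_mkSing T M _ _⟩

/-- The linear map `End(T(M)_ℚ)^∨ → P(C)` sending the linear form `a ↦ σ (a v)` to the class of
`(M, σ, v)`. -/
def ofEndDual (M : C) : EndDual T M →ₗ[ℚ] FormalPeriods (T ⋙ KQVect.singular) :=
  ∑ i, { toFun l := mkSing T M
          (l ∘ₗ LinearMap.smulRightₗ ((Module.finBasis ℚ (T.obj M).sing).coord i))
          (Module.finBasis ℚ (T.obj M).sing i)
         map_add' l m := by rw [LinearMap.add_comp, mkSing_add]
         map_smul' q l := by rw [LinearMap.smul_comp, mkSing_smul, RingHom.id_apply] }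

/-- Bilinearity of symbols removes the dependence on the chosen basis. -/
lemma ofEndDual_matrixCoefficient (M : C) (σ : Module.Dual ℚ (T.obj M).sing)
    (v : (T.obj M).sing) :
    ofEndDual T M (matrixCoefficient σ v) = mkSing T M σ v := by
  set b := Module.finBasis ℚ (T.obj M).sing
  let φ : (T.obj M).sing →ₗ[ℚ] FormalPeriods (T ⋙ KQVect.singular) :=
    { toFun v := mkSing T M σ v
      map_add' v w := mk_add_omega (T ⋙ KQVect.singular) M σ v w
      map_smul' q v := mk_smul_omega (T ⋙ KQVect.singular) M q σ v }
  have h : ∀ i, matrixCoefficient σ v ∘ₗ LinearMap.smulRightₗ (b.coord i) = b.coord i v • σ := by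
    intro i
    ext x
    exact map_smul σ (b.coord i v) x
  calc ofEndDual T M (matrixCoefficient σ v)
      = ∑ i, mkSing T M (matrixCoefficient σ v ∘ₗ
          LinearMap.smulRightₗ (b.coord i)) (b i) :=
        by rw [ofEndDual, LinearMap.sum_apply]; rfl
    _ = ∑ i, b.coord i v • φ (b i) :=
        Finset.sum_congr rfl fun i _ => by
          rw [h, mkSing_smul]; rfl
    _ = φ (∑ i, b.coord i v • b i) := by simp only [map_sum, map_smul]
    _ = φ v := congrArg φ (b.sum_repr v)

/-- The inverse of `FormalPeriods.toNori`. -/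
def ofNori : NoriCoalgebra T →ₗ[ℚ] FormalPeriods (T ⋙ KQVect.singular) := by
  classical
  exact (noriRelations T).liftQ (DFinsupp.lsum ℚ (ofEndDual T)) <| by
    refine Submodule.span_le.2 ?_
    rintro _ ⟨M, N, f, l, rfl⟩
    rw [SetLike.mem_coe, LinearMap.mem_ker, map_sub, sub_eq_zero,
      eq_sum_matrixCoefficient (Module.finBasis ℚ (T.obj M).sing) l]
    -- On a matrix coefficient with data `σ`, `v`, Nori's relation is exactly `(M, f^* σ, v) = (N,
    -- σ, f_* v)`.
    refine (DFinsupp.lsum_single _ _ _ _).trans (Eq.trans ?_ (DFinsupp.lsum_single _ _ _ _).symm)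
    simp only [map_sum]
    refine Finset.sum_congr rfl fun i _ => ?_
    set σ := l ∘ₗ LinearMap.smulRightₗ ((Module.finBasis ℚ (T.obj M).sing).coord i)
    set v := Module.finBasis ℚ (T.obj M).sing i
    exact (ofEndDual_matrixCoefficient T M (σ ∘ₗ (T.map f).sing) v).trans
      ((mk_map (T ⋙ KQVect.singular) f σ v).symm.trans
        (ofEndDual_matrixCoefficient T N σ ((T.map f).sing v)).symm)

lemma ofNori_toNori (x : FormalPeriods (T ⋙ KQVect.singular)) : ofNori T (toNori T x) = x := by
  classical
  suffices h : ofNori T ∘ₗ toNori T = LinearMap.id from LinearMap.congr_fun h x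
  refine Submodule.linearMap_qext _ (Finsupp.lhom_ext' fun s => LinearMap.ext_ring ?_)
  change ofNori T (toNori T (mk (T ⋙ KQVect.singular) s.obj s.sigma s.omega)) =
    mk (T ⋙ KQVect.singular) s.obj s.sigma s.omega
  refine (congrArg (ofNori T) (toNori_mkSing T s.obj s.sigma s.omega)).trans ?_
  refine Eq.trans ?_ (ofEndDual_matrixCoefficient T s.obj s.sigma s.omega)
  exact (Submodule.liftQ_apply _ _ _).trans (DFinsupp.lsum_single _ _ _ _)

lemma toNori_bijective : Function.Bijective (toNori T) :=
  ⟨Function.LeftInverse.injective (ofNori_toNori T), toNori_surjective T⟩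

variable {C' : Type u'} [Category.{v'} C'] (ι : C' ⥤ C)

lemma toNori_map (x : FormalPeriods ((ι ⋙ T) ⋙ KQVect.singular)) :
    toNori T (map (T ⋙ KQVect.singular) ι x) = NoriCoalgebra.map T ι (toNori (ι ⋙ T) x) := by
  classical
  suffices h : toNori T ∘ₗ map (T ⋙ KQVect.singular) ι =
      (NoriCoalgebra.map T ι).toLinearMap ∘ₗ toNori (ι ⋙ T) from LinearMap.congr_fun h x
  refine Submodule.linearMap_qext _ (Finsupp.lhom_ext' fun s => LinearMap.ext_ring ?_)
  change toNori T (map (T ⋙ KQVect.singular) ι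
      (mk (ι ⋙ T ⋙ KQVect.singular) s.obj s.sigma s.omega)) =
    NoriCoalgebra.map T ι (toNori (ι ⋙ T)
      (mk ((ι ⋙ T) ⋙ KQVect.singular) s.obj s.sigma s.omega))
  refine (congrArg (toNori T)
    (map_mk (T ⋙ KQVect.singular) ι s.obj s.sigma s.omega)).trans ?_
  refine (toNori_mkSing T (ι.obj s.obj) s.sigma s.omega).trans ?_
  refine Eq.trans ?_ (congrArg (NoriCoalgebra.map T ι)
    (toNori_mkSing (ι ⋙ T) s.obj s.sigma s.omega)).symm
  exact congrArg (noriRelations T).mkQ (endDualMap_single T ι s.obj _).symm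

end FormalPeriods

theorem injective_noriCoalgebra_map_iff {C' : Type u'} [Category.{v'} C'] (ι : C' ⥤ C) :
    Function.Injective (NoriCoalgebra.map T ι) ↔
      Function.Injective (FormalPeriods.map (T ⋙ KQVect.singular) ι) := by
  rw [← Function.Injective.of_comp_iff' _ (FormalPeriods.toNori_bijective (ι ⋙ T)),
    ← Function.Injective.of_comp_iff (FormalPeriods.toNori_bijective T).1]
  exact iff_of_eq (congrArg _ (funext fun x => (FormalPeriods.toNori_map T ι x).symm))

end Nori

end

/-! ### The equivalence of the three conditions -/

theorem mainTheorem2 (K : Subfield ℂ)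
    (C : Type u) [Category.{v} C] [Abelian C] [Linear ℚ C]
    (T : C ⥤ KQVect.{w} K) [T.Faithful] [PreservesFiniteLimits T] [PreservesFiniteColimits T]
    (C' : Type u') [Category.{v'} C'] [Abelian C'] [Linear ℚ C']
    (ι : C' ⥤ C) [ι.Faithful] [PreservesFiniteLimits ι] [PreservesFiniteColimits ι] :
    List.TFAE [ClosedUnderSubquotients ι,
      Function.Injective (FormalPeriods.map T ι),
      Function.Injective (NoriCoalgebra.map T ι)] := by
  have := comp_preservesFiniteLimits ι T
  have := comp_preservesFiniteColimits ι T
  tfae_have 1 ↔ 2 := closedUnderSubquotients_iff_injective_formalPeriods_map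
    (isFiberFunctor_of_exact T) (isFiberFunctor_of_exact (ι ⋙ T))
  tfae_have 1 ↔ 3 := by
    -- Closure under subquotients does not involve `T`, so the same equivalence applies with `T ⋙
    -- KQVect.singular` in its place.
    rw [injective_noriCoalgebra_map_iff]
    exact closedUnderSubquotients_iff_injective_formalPeriods_map
      (isFiberFunctor_comp_singular T) (isFiberFunctor_comp_singular (ι ⋙ T))
  tfae_finish
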